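/- Let $\mathsf h$ be a complex separable Hilbert space and $\mathcal B(\mathsf h)$ the algebra of bounded operators on $\mathsf h$, with the weak$^*$ topology it carries as the dual of the trace class operators (the coarsest topology making $x\mapsto \operatorname{tr}(\eta x)$ continuous for every trace class operator $\eta$). Let $\mathcal T=(\mathcal T_t)_{t\ge 0}$ be a quantum Markov semigroup on $\mathcal B(\mathsf h)$, i.e. a family of completely positive linear maps on $\mathcal B(\mathsf h)$ with $\mathcal T_t(\mathbf 1)=\mathbf 1$ for all $t\ge 0$, each of them normal (continuous for the weak$^*$ topology), such that $\mathcal T_0$ is the identity map, $\mathcal T_{s+t}=\mathcal T_s\mathcal T_t$ for all $s,t\ge 0$, and $t\mapsto\mathcal T_t(x)$ is weak$^*$ continuous on $[0,\infty)$ for every $x\in\mathcal B(\mathsf h)$. Let $\rho$ be an invariant density, i.e. a positive trace class operator on $\mathsf h$ with $\operatorname{tr}(\rho)=1$ and $\operatorname{tr}(\rho\,\mathcal T_t(x))=\operatorname{tr}(\rho x)$ for all $t\ge 0$ and $x\in\mathcal B(\mathsf h)$. Then the support projection $p$ of $\rho$, that is, the orthogonal projection onto the closure of the range of $\rho$, is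 subharmonic: $p$ is an orthogonal projection and $\mathcal T_t(p)\ge p$ for all $t\ge 0$. -/

import Mathlib

open scoped InnerProductSpace NNReal Topology CStarAlgebra

noncomputable section

namespace QuantumMarkov

variable {H : Type*} [NormedAddCommGroup H] [InnerProductSpace ℂ H] [CompleteSpace H]

variable (H) in
/-- Index set of a fixed orthonormal basis of `H`. -/
def basisIndex : Set H := (exists_hilbertBasis ℂ H).choose

variable (H) in
/-- A fixed orthonormal (Hilbert) basis of `H`, used to compute traces. -/
def basis : HilbertBasis (basisIndex H) ℂ H := (exists_hilbertBasis ℂ H).choose_spec.choose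

/-- `A` is trace class: `∑ᵢ ⟨eᵢ, |A| eᵢ⟩ < ∞`, where `|A| = (A* A)^{1/2}`. The terms are
nonnegative reals, and the condition does not depend on the orthonormal basis. -/
def IsTraceClass (A : H →L[ℂ] H) : Prop :=
  Summable fun i => (⟪basis H i, CFC.abs A (basis H i)⟫_ℂ).re

/-- The trace `∑ᵢ ⟨eᵢ, A eᵢ⟩`; for trace class `A` the series converges absolutely and its sum
does not depend on the orthonormal basis. It is only used on trace class operators. -/
def trace (A : H →L[ℂ] H) : ℂ :=
  ∑' i, ⟪basis H i, A (basis H i)⟫_ℂ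

variable (H) in
/-- The weak* topology of `B(H)` as the dual of the trace class operators: the coarsest topology
for which `x ↦ tr(η x)` is continuous for every trace class `η`. -/
@[reducible] def weakStar : TopologicalSpace (H →L[ℂ] H) :=
  ⨅ η : {η : H →L[ℂ] H // IsTraceClass η},
    TopologicalSpace.induced (fun x => trace (η.1 * x)) inferInstance

variable (H) in
/-- A quantum Markov semigroup on `B(H)`: a weak*-continuous one-parameter semigroup of completely
positive, identity preserving, normal maps. -/
structure QMS where
  /-- The completely positive maps `T_t`, `t ≥ 0`. -/
  map : ℝ≥0 → ((H →L[ℂ] H) →CP (H →L[ℂ] H))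
  map_zero : ∀ x, map 0 x = x
  map_add : ∀ s t x, map (s + t) x = map s (map t x)
  map_one : ∀ t, map t 1 = 1
  normal : ∀ t, Continuous[weakStar H, weakStar H] (map t)
  weakStar_continuous : ∀ x, Continuous[inferInstance, weakStar H] (fun t => map t x)

/-- A density: a positive trace class operator of unit trace. -/
structure IsDensity (ρ : H →L[ℂ] H) : Prop where
  nonneg : 0 ≤ ρ
  traceClass : IsTraceClass ρ
  trace_eq_one : trace ρ = 1

/-- The density `ρ` is invariant for `T`: `tr(ρ T_t(x)) = tr(ρ x)` for all `t ≥ 0` and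
`x ∈ B(H)`. As the predual map `T_{*t}` is determined by `tr(T_{*t}(η) x) = tr(η T_t(x))`,
this says `T_{*t}(ρ) = ρ`. -/
def QMS.IsInvariantDensity (T : QMS H) (ρ : H →L[ℂ] H) : Prop :=
  IsDensity ρ ∧ ∀ t x, trace (ρ * T.map t x) = trace (ρ * x)

/-- The support projection: the orthogonal projection onto the closure of the range of `ρ`. -/
def supportProjection (ρ : H →L[ℂ] H) : H →L[ℂ] H :=
  (LinearMap.range (ρ : H →ₗ[ℂ] H)).topologicalClosure.starProjection

/-- `p` is subharmonic for `T`: an orthogonal projection with `T_t(p) ≥ p` for all `t ≥ 0`. -/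
def QMS.IsSubharmonic (T : QMS H) (p : H →L[ℂ] H) : Prop :=
  IsStarProjection p ∧ ∀ t, p ≤ T.map t p

end QuantumMarkov

end

open scoped InnerProductSpace NNReal Topology CStarAlgebra

namespace QuantumMarkov

section HilbertSchmidt

variable {ι H : Type*} [NormedAddCommGroup H] [InnerProductSpace ℂ H]

/-! Put `x = T_t(p)`, so `0 ≤ x ≤ 1`. Invariance and `ρ p = ρ` give `tr(ρ x) = tr ρ`, so the
nonnegative quantity `tr(ρ (1 - x)) = ∑ ‖√(1 - x) √ρ eᵢ‖²` vanishes. Hence `√(1 - x) √ρ = 0`, so `x`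
fixes the range of `ρ` and, by continuity, its closure: `x p = p`. For positive `x` this forces `x ≥
p`. The analytic work is the symmetric form `tr(ρ x) = tr(√ρ x √ρ)` (`hasSum_trace_mul`), which
exposes the sum of squares; it follows from cyclicity of the trace on products of Hilbert-Schmidt
operators. -/

/-- Parseval's identity in terms of squared norms. -/
theorem hasSum_norm_inner_sq (b : HilbertBasis ι ℂ H) (x : H) :
    HasSum (fun j => ‖⟪b j, x⟫_ℂ‖ ^ 2) (‖x‖ ^ 2) := by
  have h := Complex.hasSum_re (b.hasSum_inner_mul_inner x x)
  rw [inner_self_eq_norm_sq_to_K] at h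
  convert h using 1
  · funext j
    rw [← inner_conj_symm x (b j), Complex.conj_mul']
    norm_cast
  · norm_cast

/-- The matrix coefficients of a Hilbert-Schmidt operator are square summable. -/
theorem summable_norm_inner_sq (b : HilbertBasis ι ℂ H) {A : H →L[ℂ] H}
    (hA : Summable fun i => ‖A (b i)‖ ^ 2) :
    Summable fun q : ι × ι => ‖⟪b q.2, A (b q.1)⟫_ℂ‖ ^ 2 := by
  rw [summable_prod_of_nonneg fun _ => by positivity]
  refine ⟨fun i => (hasSum_norm_inner_sq b (A (b i))).summable, ?_⟩
  simpa only [(hasSum_norm_inner_sq b (A (b _))).tsum_eq] using hA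

variable [CompleteSpace H]

/-- The adjoint of a Hilbert-Schmidt operator is Hilbert-Schmidt. -/
theorem summable_norm_adjoint_sq (b : HilbertBasis ι ℂ H) {A : H →L[ℂ] H}
    (hA : Summable fun i => ‖A (b i)‖ ^ 2) :
    Summable fun i => ‖(star A) (b i)‖ ^ 2 := by
  have h := (summable_norm_inner_sq b hA).prod_symm.prod
  refine h.congr fun i => ?_
  rw [← (hasSum_norm_inner_sq b ((star A) (b i))).tsum_eq]
  refine tsum_congr fun j => ?_
  rw [ContinuousLinearMap.star_eq_adjoint, ContinuousLinearMap.adjoint_inner_right,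
    norm_inner_symm]
  rfl

/-- For Hilbert-Schmidt operators, `tr (A* B) = tr (B A*)`. -/
theorem hasSum_inner_adjoint (b : HilbertBasis ι ℂ H) {A B : H →L[ℂ] H}
    (hA : Summable fun i => ‖A (b i)‖ ^ 2) (hB : Summable fun i => ‖B (b i)‖ ^ 2) :
    HasSum (fun j => ⟪(star B) (b j), (star A) (b j)⟫_ℂ) (∑' i, ⟪A (b i), B (b i)⟫_ℂ) := by
  let f : ι × ι → ℂ := fun q => ⟪A (b q.1), b q.2⟫_ℂ * ⟪b q.2, B (b q.1)⟫_ℂ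
  -- Absolute summability over pairs, from `ab ≤ a² + b²`, is what permits exchanging the two sums.
  have hf : Summable f := by
    refine Summable.of_norm_bounded
      ((summable_norm_inner_sq b hA).add (summable_norm_inner_sq b hB)) fun q => ?_
    rw [norm_mul, norm_inner_symm]
    nlinarith [sq_nonneg (‖⟪b q.2, A (b q.1)⟫_ℂ‖ - ‖⟪b q.2, B (b q.1)⟫_ℂ‖),
      sq_nonneg (‖⟪b q.2, A (b q.1)⟫_ℂ‖ + ‖⟪b q.2, B (b q.1)⟫_ℂ‖)]
  have h₁ : ∑' q, f q = ∑' i, ⟪A (b i), B (b i)⟫_ℂ := by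
    rw [hf.tsum_prod]
    exact tsum_congr fun i => (b.hasSum_inner_mul_inner (A (b i)) (B (b i))).tsum_eq
  rw [← h₁]
  refine HasSum.prod_fiberwise (f := f ∘ Prod.swap)
    ((Equiv.prodComm ι ι).hasSum_iff.2 hf.hasSum) fun j => ?_
  have hj : (fun i => (f ∘ Prod.swap) (j, i)) =
      fun i => ⟪(star B) (b j), b i⟫_ℂ * ⟪b i, (star A) (b j)⟫_ℂ := by
    funext i
    simp only [f, Function.comp, Prod.swap, ContinuousLinearMap.star_eq_adjoint,
      ContinuousLinearMap.adjoint_inner_right, ContinuousLinearMap.adjoint_inner_left]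
    ring
  rw [hj]
  exact b.hasSum_inner_mul_inner ((star B) (b j)) ((star A) (b j))

end HilbertSchmidt

variable {H : Type*} [NormedAddCommGroup H] [InnerProductSpace ℂ H] [CompleteSpace H]

/-- The square root of a positive trace class operator is Hilbert-Schmidt. -/
theorem summable_norm_sqrt_sq {ρ : H →L[ℂ] H} (h₀ : 0 ≤ ρ) (hρ : IsTraceClass ρ) :
    Summable fun i => ‖CFC.sqrt ρ (basis H i)‖ ^ 2 := by
  have hs : IsSelfAdjoint (CFC.sqrt ρ) := (CFC.sqrt_nonneg ρ).isSelfAdjoint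
  rw [IsTraceClass, CFC.abs_of_nonneg ρ h₀] at hρ
  convert hρ using 2 with i
  conv_rhs => rw [← CFC.sqrt_mul_sqrt_self ρ h₀]
  rw [mul_apply_eq_comp, ← ContinuousLinearMap.adjoint_inner_left,
    hs.adjoint_eq, inner_self_eq_norm_sq_to_K]
  norm_cast

/-- For a positive trace class `ρ`, `tr (ρ x) = tr (√ρ x √ρ)`. -/
theorem hasSum_trace_mul {ρ : H →L[ℂ] H} (h₀ : 0 ≤ ρ) (hρ : IsTraceClass ρ) (x : H →L[ℂ] H) :
    HasSum (fun i => ⟪CFC.sqrt ρ (basis H i), x (CFC.sqrt ρ (basis H i))⟫_ℂ)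
      (trace (ρ * x)) := by
  have hs : IsSelfAdjoint (CFC.sqrt ρ) := (CFC.sqrt_nonneg ρ).isSelfAdjoint
  have hA := summable_norm_sqrt_sq h₀ hρ
  have hxs (y : H →L[ℂ] H) : Summable fun i => ‖(y * CFC.sqrt ρ) (basis H i)‖ ^ 2 := by
    refine Summable.of_nonneg_of_le (fun _ => by positivity) (fun i => ?_)
      (hA.mul_left (‖y‖ ^ 2))
    rw [← mul_pow]
    gcongr
    exact y.le_opNorm _
  -- `√ρ x` is the adjoint of `x* √ρ`, whose Hilbert-Schmidt bound is immediate from `‖x*‖`.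
  have hB : Summable fun i => ‖(CFC.sqrt ρ * x) (basis H i)‖ ^ 2 := by
    simpa [hs.star_eq] using summable_norm_adjoint_sq (basis H) (hxs (star x))
  have h := hasSum_inner_adjoint (basis H) hA hB
  convert h using 1
  · funext i
    rw [star_mul, hs.star_eq, mul_apply_eq_comp,
      ContinuousLinearMap.star_eq_adjoint, ContinuousLinearMap.adjoint_inner_left]
  · refine tsum_congr fun i => ?_
    conv_lhs => rw [← CFC.sqrt_mul_sqrt_self ρ h₀, mul_assoc]
    rw [mul_apply_eq_comp, ← ContinuousLinearMap.adjoint_inner_left, hs.adjoint_eq]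

/-- If `x ≤ 1` has full expectation in the state `ρ`, then `x` fixes the range of `ρ`. -/
theorem mul_eq_self_of_trace_mul_eq {ρ x : H →L[ℂ] H} (h₀ : 0 ≤ ρ) (hρ : IsTraceClass ρ)
    (hx : x ≤ 1) (h : trace (ρ * x) = trace ρ) : x * ρ = ρ := by
  have hy : 0 ≤ 1 - x := sub_nonneg.2 hx
  have hz : IsSelfAdjoint (CFC.sqrt (1 - x)) := (CFC.sqrt_nonneg (1 - x)).isSelfAdjoint
  have hsum := (hasSum_trace_mul h₀ hρ 1).sub (hasSum_trace_mul h₀ hρ x)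
  rw [mul_one, h, sub_self] at hsum
  have hsum' : HasSum (fun i => ‖CFC.sqrt (1 - x) (CFC.sqrt ρ (basis H i))‖ ^ 2) 0 := by
    rw [← Complex.zero_re]
    convert Complex.hasSum_re hsum using 1
    funext i
    rw [← inner_sub_right, ← sub_apply]
    conv_rhs => rw [← CFC.sqrt_mul_sqrt_self (1 - x) hy]
    rw [mul_apply_eq_comp, ← ContinuousLinearMap.adjoint_inner_left,
      hz.adjoint_eq, inner_self_eq_norm_sq_to_K]
    norm_cast
  have hzero := (hasSum_zero_iff_of_nonneg fun i => by positivity).1 hsum'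
  have hzs : CFC.sqrt (1 - x) * CFC.sqrt ρ = 0 := by
    refine ContinuousLinearMap.ext_on
      (Submodule.dense_iff_topologicalClosure_eq_top.2 (basis H).dense_span) ?_
    rintro _ ⟨i, rfl⟩
    simpa using congrFun hzero i
  have : (1 - x) * ρ = 0 := by
    conv_lhs => rw [← CFC.sqrt_mul_sqrt_self (1 - x) hy, ← CFC.sqrt_mul_sqrt_self ρ h₀]
    rw [mul_assoc, ← mul_assoc _ (CFC.sqrt ρ), hzs, zero_mul, mul_zero]
  rw [sub_mul, one_mul, sub_eq_zero] at this
  exact this.symm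

theorem isStarProjection_supportProjection (ρ : H →L[ℂ] H) :
    IsStarProjection (supportProjection ρ) :=
  isStarProjection_starProjection

theorem supportProjection_mul_self (ρ : H →L[ℂ] H) : supportProjection ρ * ρ = ρ := by
  ext v
  exact Submodule.starProjection_eq_self_iff.2
    (Submodule.le_topologicalClosure _ (LinearMap.mem_range_self _ v))

/-- An operator which fixes the range of `ρ` fixes the support of `ρ`. -/
theorem mul_supportProjection_eq_self {ρ x : H →L[ℂ] H} (h : x * ρ = ρ) :
    x * supportProjection ρ = supportProjection ρ := by
  ext v
  have hle : (LinearMap.range (ρ : H →ₗ[ℂ] H)).topologicalClosure ≤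
      LinearMap.ker ((x - 1 : H →L[ℂ] H) : H →ₗ[ℂ] H) := by
    refine Submodule.topologicalClosure_minimal _ ?_ (x - 1).isClosed_ker
    rintro _ ⟨w, rfl⟩
    simpa [sub_eq_zero] using congrArg (fun a : H →L[ℂ] H => a w) h
  have := hle (Submodule.starProjection_apply_mem _ v)
  simpa [supportProjection, sub_eq_zero] using this

end QuantumMarkov

/-- A positive operator which acts as the identity on a projection dominates it. -/
theorem IsStarProjection.le_of_mul_eq_self {H : Type*} [NormedAddCommGroup H]
    [InnerProductSpace ℂ H] [CompleteSpace H] {p x : H →L[ℂ] H} (hp : IsStarProjection p)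
    (hx : 0 ≤ x) (h : x * p = p) : p ≤ x := by
  have h' : p * x = p := by
    simpa [hp.isSelfAdjoint.star_eq, hx.isSelfAdjoint.star_eq] using congrArg star h
  have h₁ := (hp.one_sub.isSelfAdjoint).conjugate_nonneg hx
  -- `x` commutes with `p` and is the identity on its range, so `x - p` is the compression of `x` to
  -- the complement, hence positive.
  have h₂ : (1 - p) * x * (1 - p) = x - p := by
    rw [sub_mul, one_mul, h', mul_sub, mul_one, sub_mul, h, hp.isIdempotentElem.eq]
    simp
  rwa [h₂, sub_nonneg] at h₁

theorem proposition2p1 {H : Type*} [NormedAddCommGroup H] [InnerProductSpace ℂ H]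
    [CompleteSpace H] [TopologicalSpace.SeparableSpace H]
    (T : QuantumMarkov.QMS H) (ρ : H →L[ℂ] H) (hρ : T.IsInvariantDensity ρ) :
    T.IsSubharmonic (QuantumMarkov.supportProjection ρ) := by
  obtain ⟨⟨h₀, htc, -⟩, hinv⟩ := hρ
  have hp := QuantumMarkov.isStarProjection_supportProjection ρ
  refine ⟨hp, fun t => ?_⟩
  have hmono : Monotone (T.map t) := OrderHomClass.mono (T.map t)
  have h_one : T.map t (QuantumMarkov.supportProjection ρ) ≤ 1 :=
    (hmono hp.le_one).trans_eq (T.map_one t)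
  have h_nonneg : 0 ≤ T.map t (QuantumMarkov.supportProjection ρ) :=
    (map_zero (T.map t)).symm.trans_le (hmono hp.nonneg)
  have hmul : ρ * QuantumMarkov.supportProjection ρ = ρ := by
    simpa [hp.isSelfAdjoint.star_eq, h₀.isSelfAdjoint.star_eq] using
      congrArg star (QuantumMarkov.supportProjection_mul_self ρ)
  refine hp.le_of_mul_eq_self h_nonneg (QuantumMarkov.mul_supportProjection_eq_self
    (QuantumMarkov.mul_eq_self_of_trace_mul_eq h₀ htc h_one ?_))
  -- `tr(ρ T_t(p)) = tr(ρ p) = tr ρ`.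
  rw [hinv, hmul]
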